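/- All graphs are finite and simple. For a connected graph $G$, a locating $k$-coloring is a proper coloring of $V(G)$ with $k$ nonempty color classes $C_1,\dots,C_k$ such that distinct vertices $v$ have distinct color codes $(d(v,C_1),\dots,d(v,C_k))$, where $d(v,C_i)=\min\{d(v,x)\mid x\in C_i\}$; the locating-chromatic number $\chi_L(G)$ is the least $k$ for which $G$ has a locating $k$-coloring. The corona product $G\odot H$ is obtained from one copy of $G$ and $|V(G)|$ copies of $H$, one for each vertex of $G$, by joining each vertex $u$ of $G$ to every vertex of the copy of $H$ that belongs to $u$. Let $\overline{K_1}$ be the graph with one vertex and no edge, $P_6$ the path with $6$ vertices, and $G_3$ the tree with $6$ vertices obtained from the path with $5$ vertices by attaching one pendant vertex to its middle vertex. Theorem. For $n\ge 2$, let $T_n$ be a tree with $n$ vertices such that $\chi_L(T_n)=3$. Then $$\chi_L(T_n\odot \overline{K_1})=\begin{cases}3, & \text{if } T_n \text{ is isomorphic to a subgraph of } P_6 \text{ or of } G_3,\\ 4, & \text{otherwise.}\end{cases}$$ -/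

import Mathlib

namespace LocatingChromatic

/-- The distance `d(v, S) = min {d(v, x) | x ∈ S}` from a vertex to a (nonempty) vertex set. -/
noncomputable def distToSet {V : Type*} (G : SimpleGraph V) (v : V) (S : Set V) : ℕ :=
  sInf (G.dist v '' S)

/-- The color code of a vertex with respect to a coloring: its distances to all color classes. -/
noncomputable def colorCode {V : Type*} (G : SimpleGraph V) {k : ℕ} (c : G.Coloring (Fin k))
    (v : V) : Fin k → ℕ :=
  fun i => distToSet G v (c.colorClass i)

/-- A locating coloring: a proper coloring with `k` nonempty color classes such that distinct
vertices have distinct color codes. -/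
def IsLocatingColoring {V : Type*} (G : SimpleGraph V) {k : ℕ} (c : G.Coloring (Fin k)) : Prop :=
  Function.Surjective c ∧ Function.Injective (colorCode G c)

/-- The locating-chromatic number `χ_L(G)` of a finite connected graph: the least `k` such that
`G` has a locating coloring with `k` colors. -/
noncomputable def locatingChromaticNumber {V : Type*} (G : SimpleGraph V) : ℕ :=
  sInf {k : ℕ | ∃ c : G.Coloring (Fin k), IsLocatingColoring G c}

/-- The adjacency relation of the corona product: `Sum.inl u` is the vertex `u` of `G`, and
`Sum.inr (u, x)` is the vertex `x` of the copy of `H` attached to `u`. -/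
def coronaAdj {V W : Type*} (G : SimpleGraph V) (H : SimpleGraph W) :
    V ⊕ V × W → V ⊕ V × W → Prop
  | Sum.inl u, Sum.inl v => G.Adj u v
  | Sum.inl u, Sum.inr p => u = p.1
  | Sum.inr p, Sum.inl u => p.1 = u
  | Sum.inr p, Sum.inr q => p.1 = q.1 ∧ H.Adj p.2 q.2

/-- The corona product `G ⊙ H`: one copy of `G` and, for each vertex `u` of `G`, a copy of `H`
all of whose vertices are joined to `u`. -/
def corona {V W : Type*} (G : SimpleGraph V) (H : SimpleGraph W) :
    SimpleGraph (V ⊕ V × W) where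
  Adj := coronaAdj G H
  symm := ⟨by
    rintro (u | p) (v | q) h
    · exact G.adj_symm h
    · exact Eq.symm h
    · exact Eq.symm h
    · exact ⟨h.1.symm, H.adj_symm h.2⟩⟩
  loopless := ⟨by
    rintro (u | p) h
    · exact G.irrefl h
    · exact H.irrefl h.2⟩

/-- The tree `G₃`: the path `0 - 1 - 2 - 3 - 4` with a pendant vertex `5` attached to its middle
vertex `2`. -/
def graphG3 : SimpleGraph (Fin 6) :=
  SimpleGraph.fromEdgeSet {s(0, 1), s(1, 2), s(2, 3), s(3, 4), s(2, 5)}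

end LocatingChromatic

/-!
A locating coloring of the corona of a tree `T` with `K₁` in three colors is read on `T`: every
vertex has a color, a color for its pendant vertex, and the distance to the third color. Call a
vertex near if that distance is one; distinct near vertices have distinct colors, so there are at
most three of them. The other vertices are at distance two from the third color, since otherwise a
vertex would share its code with the pendant vertex of its neighbor on the way to that color. So
each of them is adjacent to a near vertex, and comparing codes with pendant vertices once more, no
near vertex has two such neighbors. Hence `T` has at most six vertices. If all degrees are at most
two, `T` is a path; a vertex of degree at least three is near and has two near neighbors, so that
the three near vertices form a path with at most one further vertex attached to each, which is a
subgraph of `G₃`.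

Conversely these trees are colored explicitly, and giving a fourth color to all pendant vertices
extends any locating coloring of `T` in three colors.
-/

namespace LocatingChromatic

open SimpleGraph

section DistToSet

variable {V : Type*} {G : SimpleGraph V}

theorem distToSet_le (v : V) {S : Set V} {x : V} (hx : x ∈ S) : distToSet G v S ≤ G.dist v x :=
  Nat.sInf_le ⟨x, hx, rfl⟩

theorem exists_dist_eq_distToSet (v : V) {S : Set V} (hS : S.Nonempty) :
    ∃ x ∈ S, G.dist v x = distToSet G v S :=
  Nat.sInf_mem (hS.image (G.dist v))

theorem distToSet_eq_zero_iff (hG : G.Connected) {v : V} {S : Set V} (hS : S.Nonempty) :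
    distToSet G v S = 0 ↔ v ∈ S := by
  constructor
  · intro h
    obtain ⟨x, hx, hd⟩ := exists_dist_eq_distToSet (G := G) v hS
    rw [h, hG.dist_eq_zero_iff] at hd
    exact hd ▸ hx
  · intro h
    simpa using distToSet_le (G := G) v h

theorem distToSet_le_distToSet_add_one (hG : G.Connected) {u v : V} (h : G.Adj u v) {S : Set V}
    (hS : S.Nonempty) : distToSet G u S ≤ distToSet G v S + 1 := by
  obtain ⟨x, hx, hd⟩ := exists_dist_eq_distToSet (G := G) v hS
  calc distToSet G u S ≤ G.dist u x := distToSet_le u hx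
    _ ≤ G.dist u v + G.dist v x := hG.dist_triangle
    _ = distToSet G v S + 1 := by rw [dist_eq_one_iff_adj.2 h, hd, add_comm]

theorem exists_adj_distToSet_add_one_eq (hG : G.Connected) {v : V} {S : Set V} (hS : S.Nonempty)
    (hv : distToSet G v S ≠ 0) : ∃ w, G.Adj v w ∧ distToSet G w S + 1 = distToSet G v S := by
  obtain ⟨x, hx, hd⟩ := exists_dist_eq_distToSet (G := G) v hS
  obtain ⟨p, hp⟩ := hG.exists_walk_length_eq_dist v x
  cases p with
  | nil => exact (hv (by simpa using hd.symm)).elim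
  | @cons _ w _ h q =>
    refine ⟨w, h, le_antisymm ?_ (distToSet_le_distToSet_add_one hG h hS)⟩
    have hw := (distToSet_le (G := G) w hx).trans (dist_le q)
    rw [Walk.length_cons] at hp
    omega

theorem exists_adj_dist_add_one_eq (hG : G.Connected) {r v : V} (h : v ≠ r) :
    ∃ w, G.Adj v w ∧ G.dist r w + 1 = G.dist r v := by
  have hd : ∀ x, distToSet G x {r} = G.dist r x := fun x => by simp [distToSet, dist_comm]
  simpa only [hd] using exists_adj_distToSet_add_one_eq hG (Set.singleton_nonempty r)
    ((distToSet_eq_zero_iff hG (Set.singleton_nonempty r)).not.2 h)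

end DistToSet

/-- The local properties of color codes: `g` satisfies them exactly when `g v i` is the distance
from `v` to the color class `i` (`IsLocalCode.colorCode_eq`), but they only refer to adjacent
vertices. -/
structure IsLocalCode {V : Type*} {k : ℕ} (G : SimpleGraph V) (c : V → Fin k)
    (g : V → Fin k → ℕ) : Prop where
  eq_zero_iff : ∀ v i, g v i = 0 ↔ c v = i
  le_add_one : ∀ u v, G.Adj u v → ∀ i, g u i ≤ g v i + 1
  exists_adj : ∀ v i, g v i ≠ 0 → ∃ w, G.Adj v w ∧ g w i + 1 = g v i

section IsLocalCode

variable {V : Type*} {G : SimpleGraph V} {k : ℕ} {c : V → Fin k} {g : V → Fin k → ℕ}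

namespace IsLocalCode

theorem exists_walk_length_eq (hg : IsLocalCode G c g) (v : V) (i : Fin k) :
    ∃ x, c x = i ∧ ∃ p : G.Walk v x, p.length = g v i := by
  induction hn : g v i generalizing v with
  | zero => exact ⟨v, (hg.eq_zero_iff v i).1 hn, .nil, rfl⟩
  | succ n ih =>
    obtain ⟨w, hvw, hw⟩ := hg.exists_adj v i (by omega)
    obtain ⟨x, hx, p, hp⟩ := ih w (by omega)
    exact ⟨x, hx, .cons hvw p, by rw [Walk.length_cons, hp]⟩

theorem le_add_length (hg : IsLocalCode G c g) {u v : V} (p : G.Walk u v) (i : Fin k) :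
    g u i ≤ g v i + p.length := by
  induction p with
  | nil => exact le_self_add
  | cons h q ih =>
    have := hg.le_add_one _ _ h i
    rw [Walk.length_cons]
    omega

theorem surjective [Nonempty V] (hg : IsLocalCode G c g) : Function.Surjective c := fun i =>
  let ⟨x, hx, _⟩ := hg.exists_walk_length_eq (Classical.arbitrary V) i
  ⟨x, hx⟩

theorem colorCode_eq (hG : G.Connected) {C : G.Coloring (Fin k)} (hg : IsLocalCode G C g) :
    colorCode G C = g := by
  funext v i
  obtain ⟨x, hx, p, hp⟩ := hg.exists_walk_length_eq v i
  have hxC : x ∈ C.colorClass i := hx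
  obtain ⟨y, hy, hd⟩ := exists_dist_eq_distToSet (G := G) v ⟨x, hxC⟩
  obtain ⟨q, hq⟩ := hG.exists_walk_length_eq_dist v y
  apply le_antisymm
  · exact (distToSet_le v hxC).trans ((dist_le p).trans hp.le)
  · calc g v i ≤ g y i + q.length := hg.le_add_length q i
      _ = colorCode G C v i := by rw [(hg.eq_zero_iff y i).2 hy, zero_add, hq, hd, colorCode]

end IsLocalCode

theorem isLocalCode_colorCode (hG : G.Connected) {C : G.Coloring (Fin k)}
    (hC : Function.Surjective C) : IsLocalCode G C (colorCode G C) where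
  eq_zero_iff _ i := distToSet_eq_zero_iff hG (hC i)
  le_add_one _ _ h i := distToSet_le_distToSet_add_one hG h (hC i)
  exists_adj _ i h := exists_adj_distToSet_add_one_eq hG (hC i) h

theorem isLocatingColoring_iff (hG : G.Connected) {C : G.Coloring (Fin k)} :
    IsLocatingColoring G C ↔ ∃ g, IsLocalCode G C g ∧ Function.Injective g := by
  have := hG.nonempty
  refine ⟨fun h => ⟨_, isLocalCode_colorCode hG h.1, h.2⟩, ?_⟩
  rintro ⟨g, hg, hinj⟩
  exact ⟨hg.surjective, hg.colorCode_eq hG ▸ hinj⟩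

end IsLocalCode

/-- `G` has a locating coloring with `k` colors; `locatingChromaticNumber G` is the least such
`k`. -/
def HasLocatingColoring {V : Type*} (G : SimpleGraph V) (k : ℕ) : Prop :=
  ∃ c : G.Coloring (Fin k), IsLocatingColoring G c

section HasLocatingColoring

variable {V : Type*} {G : SimpleGraph V} {k : ℕ}

theorem HasLocatingColoring.locatingChromaticNumber_le (h : HasLocatingColoring G k) :
    locatingChromaticNumber G ≤ k :=
  Nat.sInf_le h

theorem HasLocatingColoring.hasLocatingColoring_locatingChromaticNumber
    (h : HasLocatingColoring G k) : HasLocatingColoring G (locatingChromaticNumber G) :=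
  Nat.sInf_mem (s := {k | HasLocatingColoring G k}) ⟨k, h⟩

-- `locatingChromaticNumber G = 0` is also the junk value of a graph without locating colorings.
theorem hasLocatingColoring_of_locatingChromaticNumber_eq (hk : k ≠ 0)
    (h : locatingChromaticNumber G = k) : HasLocatingColoring G k := by
  subst h
  exact Nat.sInf_mem (s := {k | HasLocatingColoring G k})
    (Nat.nonempty_of_pos_sInf (Nat.pos_of_ne_zero hk))

theorem hasLocatingColoring_iff (hG : G.Connected) :
    HasLocatingColoring G k ↔ ∃ (c : V → Fin k) (g : V → Fin k → ℕ),
      (∀ u v, G.Adj u v → c u ≠ c v) ∧ IsLocalCode G c g ∧ Function.Injective g := by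
  constructor
  · rintro ⟨C, hC⟩
    obtain ⟨g, hg⟩ := (isLocatingColoring_iff hG).1 hC
    exact ⟨C, g, fun _ _ => C.valid, hg⟩
  · rintro ⟨c, g, hc, hg⟩
    exact ⟨Coloring.mk c (hc _ _), (isLocatingColoring_iff hG).2 ⟨g, hg⟩⟩

end HasLocatingColoring

section Corona

variable {V W : Type*} {G : SimpleGraph V} {H : SimpleGraph W}

theorem corona_adj_inl_inl {u v : V} :
    (corona G H).Adj (Sum.inl u) (Sum.inl v) ↔ G.Adj u v := Iff.rfl

theorem corona_adj_inl_inr {u : V} {p : V × W} :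
    (corona G H).Adj (Sum.inl u) (Sum.inr p) ↔ u = p.1 := Iff.rfl

theorem corona_connected (hG : G.Connected) : (corona G H).Connected := by
  have := hG.nonempty
  have reachable_inl (u v : V) : (corona G H).Reachable (Sum.inl u) (Sum.inl v) :=
    (hG u v).map ⟨Sum.inl, corona_adj_inl_inl.2⟩
  have reachable_inr (p : V × W) : (corona G H).Reachable (Sum.inl p.1) (Sum.inr p) :=
    Adj.reachable (corona_adj_inl_inr.2 rfl)
  refine Connected.mk ?_
  rintro (u | p) (v | q)
  · exact reachable_inl u v
  · exact (reachable_inl u q.1).trans (reachable_inr q)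
  · exact (reachable_inr p).symm.trans (reachable_inl p.1 v)
  · exact (reachable_inr p).symm.trans ((reachable_inl p.1 q.1).trans (reachable_inr q))

end Corona

/-- The color code of the pendant vertex at `v` in the corona of a graph with a one-vertex graph,
when that pendant vertex has color `c' v` and `v` has color code `g v`. -/
def pendantCode {V : Type*} {k : ℕ} (c' : V → Fin k) (g : V → Fin k → ℕ) (v : V) (i : Fin k) : ℕ :=
  if c' v = i then 0 else g v i + 1

/-- A locating coloring of the corona of `G` with a one-vertex graph, read on `G`: the vertex `v`
has color `c v` and color code `g v`, and the pendant vertex at `v` has color `c' v`. -/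
structure IsPendantLocatingCode {V : Type*} {k : ℕ} (G : SimpleGraph V) (c c' : V → Fin k)
    (g : V → Fin k → ℕ) : Prop where
  color_ne : ∀ u v, G.Adj u v → c u ≠ c v
  eq_zero_iff : ∀ v i, g v i = 0 ↔ c v = i
  eq_one : ∀ v, g v (c' v) = 1
  le_add_one : ∀ u v, G.Adj u v → ∀ i, g u i ≤ g v i + 1
  exists_adj : ∀ v i, c v ≠ i → c' v ≠ i → ∃ w, G.Adj v w ∧ g w i + 1 = g v i
  injective : Function.Injective g
  ne_pendantCode : ∀ u v, g u ≠ pendantCode c' g v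

namespace IsPendantLocatingCode

variable {V W : Type*} {G : SimpleGraph V} {k : ℕ} {c c' : V → Fin k} {g : V → Fin k → ℕ}

theorem color_ne_pendant (hg : IsPendantLocatingCode G c c' g) (v : V) : c v ≠ c' v := fun h =>
  one_ne_zero ((hg.eq_one v).symm.trans ((hg.eq_zero_iff v _).2 h))

theorem pendantCode_injective (hg : IsPendantLocatingCode G c c' g) :
    Function.Injective (pendantCode c' g) := by
  intro u v huv
  have hcode (i : Fin k) : pendantCode c' g u i = pendantCode c' g v i := congrFun huv i
  simp only [pendantCode] at hcode
  have hc' : c' u = c' v := by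
    have := hcode (c' v)
    by_contra h
    simp [h] at this
  refine hg.injective (funext fun i => ?_)
  by_cases hi : c' u = i
  · subst hi
    rw [hg.eq_one, hc', hg.eq_one]
  · simpa [hi, hc' ▸ hi] using hcode i

theorem isLocalCode_corona [Unique W] (H : SimpleGraph W) (hg : IsPendantLocatingCode G c c' g) :
    IsLocalCode (corona G H) (Sum.elim c (c' ∘ Prod.fst))
      (Sum.elim g (pendantCode c' g ∘ Prod.fst)) where
  eq_zero_iff := by
    rintro (u | p) i
    · exact hg.eq_zero_iff u i
    · simp [pendantCode]
  le_add_one := by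
    rintro (u | p) (v | q) h i
    · exact hg.le_add_one u v h i
    · obtain rfl : u = q.1 := h
      by_cases hi : c' q.1 = i
      · subst hi
        simp [hg.eq_one]
      · simp [pendantCode, hi, add_assoc]
    · obtain rfl : p.1 = v := h
      by_cases hi : c' p.1 = i <;> simp [pendantCode, hi]
    · exact (h.2.ne (Subsingleton.elim _ _)).elim
  exists_adj := by
    rintro (u | p) i h
    · by_cases hi : c' u = i
      · subst hi
        exact ⟨Sum.inr (u, default), rfl, by simp [pendantCode, hg.eq_one]⟩
      · obtain ⟨w, hw, hwi⟩ := hg.exists_adj u i (fun hc => h ((hg.eq_zero_iff u i).2 hc)) hi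
        exact ⟨Sum.inl w, hw, hwi⟩
    · have hi : c' p.1 ≠ i := fun hi => h (by simp [pendantCode, hi])
      exact ⟨Sum.inl p.1, rfl, by simp [pendantCode, hi]⟩

theorem hasLocatingColoring_corona [Unique W] (hG : G.Connected) (H : SimpleGraph W)
    (hg : IsPendantLocatingCode G c c' g) : HasLocatingColoring (corona G H) k := by
  refine (hasLocatingColoring_iff (corona_connected hG)).2 ⟨_, _, ?_, hg.isLocalCode_corona H, ?_⟩
  · rintro (u | p) (v | q) h
    · exact hg.color_ne u v h
    · obtain rfl : u = q.1 := h
      exact hg.color_ne_pendant _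
    · obtain rfl : p.1 = v := h
      exact (hg.color_ne_pendant _).symm
    · exact (h.2.ne (Subsingleton.elim _ _)).elim
  · have hfst : Function.Injective (Prod.fst : V × W → V) := fun p q h =>
      Prod.ext h (Subsingleton.elim _ _)
    exact hg.injective.sumElim (hg.pendantCode_injective.comp hfst)
      fun u p => hg.ne_pendantCode u p.1

end IsPendantLocatingCode

section CoronaOfUnique

variable {V W : Type*} [Unique W] {G : SimpleGraph V} {H : SimpleGraph W} {k : ℕ}

theorem IsLocalCode.corona_inr_eq {c : V ⊕ V × W → Fin k} {g : V ⊕ V × W → Fin k → ℕ}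
    (hg : IsLocalCode (corona G H) c g) (v : V) :
    g (Sum.inr (v, default)) = pendantCode (fun v => c (Sum.inr (v, default))) (g ∘ Sum.inl) v := by
  funext i
  unfold pendantCode
  split_ifs with hi
  · exact (hg.eq_zero_iff _ i).2 hi
  · obtain ⟨u | p, hw, hwi⟩ := hg.exists_adj _ i ((hg.eq_zero_iff _ i).not.2 hi)
    · obtain rfl : v = u := hw
      exact hwi.symm
    · exact (hw.2.ne (Subsingleton.elim _ _)).elim

theorem IsLocalCode.isPendantLocatingCode {c : V ⊕ V × W → Fin k} {g : V ⊕ V × W → Fin k → ℕ}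
    (hc : ∀ a b, (corona G H).Adj a b → c a ≠ c b) (hg : IsLocalCode (corona G H) c g)
    (hinj : Function.Injective g) :
    IsPendantLocatingCode G (c ∘ Sum.inl) (fun v => c (Sum.inr (v, default))) (g ∘ Sum.inl) where
  color_ne u v h := hc _ _ h
  eq_zero_iff v i := hg.eq_zero_iff _ i
  eq_one v := by
    have hadj : (corona G H).Adj (Sum.inl v) (Sum.inr (v, default)) := rfl
    refine le_antisymm ?_ (Nat.one_le_iff_ne_zero.2 ((hg.eq_zero_iff _ _).not.2 (hc _ _ hadj)))
    have hle := hg.le_add_one _ _ hadj (c (Sum.inr (v, default)))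
    rwa [(hg.eq_zero_iff _ _).2 rfl] at hle
  le_add_one u v h := hg.le_add_one _ _ h
  exists_adj v i hi hi' := by
    obtain ⟨w | ⟨w, x⟩, hw, hwi⟩ := hg.exists_adj _ i ((hg.eq_zero_iff (Sum.inl v) i).not.2 hi)
    · exact ⟨w, hw, hwi⟩
    · obtain rfl : v = w := hw
      obtain rfl := Unique.eq_default x
      rw [hg.corona_inr_eq, pendantCode, if_neg hi', Function.comp_apply] at hwi
      omega
  injective := hinj.comp Sum.inl_injective
  ne_pendantCode u v h := Sum.inl_ne_inr (hinj (h.trans (hg.corona_inr_eq v).symm))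

theorem hasLocatingColoring_corona_iff (hG : G.Connected) :
    HasLocatingColoring (corona G H) k ↔
      ∃ (c c' : V → Fin k) (g : V → Fin k → ℕ), IsPendantLocatingCode G c c' g := by
  constructor
  · intro h
    obtain ⟨c, g, hc, hg, hinj⟩ := (hasLocatingColoring_iff (corona_connected hG)).1 h
    exact ⟨_, _, _, hg.isPendantLocatingCode hc hinj⟩
  · rintro ⟨c, c', g, hg⟩
    exact hg.hasLocatingColoring_corona hG H

end CoronaOfUnique

section Trees

variable {V W : Type*} {T G : SimpleGraph V} {H : SimpleGraph W}

theorem isContained_of_connected_inf_comap (hT : T.IsTree) {f : V → W}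
    (hf : Function.Injective f) (h : (T ⊓ H.comap f).Connected) : T.IsContained H :=
  ⟨⟨⟨f, fun huv => ((isTree_iff_minimal_connected.1 hT).2 h inf_le_left huv).2⟩, hf⟩⟩

theorem dist_injective_of_ncard_neighborSet_le_two [Finite V] (hG : G.Connected)
    (hdeg : ∀ v, (G.neighborSet v).ncard ≤ 2) {r : V} (hr : (G.neighborSet r).Subsingleton) :
    Function.Injective (G.dist r) := by
  suffices h : ∀ n u v, G.dist r u = n → G.dist r v = n → u = v from
    fun u v huv => h _ u v huv rfl
  intro n
  induction n with
  | zero =>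
    intro u v hu hv
    rw [hG.dist_eq_zero_iff] at hu hv
    exact hu.symm.trans hv
  | succ n ih =>
    intro u v hu hv
    obtain ⟨p, hup, hp⟩ := exists_adj_dist_add_one_eq hG (r := r) (v := u)
      (by rintro rfl; simp at hu)
    obtain ⟨q, hvq, hq⟩ := exists_adj_dist_add_one_eq hG (r := r) (v := v)
      (by rintro rfl; simp at hv)
    obtain rfl := ih p q (by omega) (by omega)
    by_cases hpr : p = r
    · subst hpr
      exact hr hup.symm hvq.symm
    · obtain ⟨s, hps, hs⟩ := exists_adj_dist_add_one_eq hG hpr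
      by_contra huv
      refine (hdeg p).not_gt ((Set.two_lt_ncard).2
        ⟨u, hup.symm, v, hvq.symm, s, hps, huv, ?_, ?_⟩) <;> rintro rfl <;> omega

theorem exists_subsingleton_neighborSet [Finite V] (hT : T.IsTree) :
    ∃ r, (T.neighborSet r).Subsingleton := by
  classical
  have := Fintype.ofFinite V
  have := hT.connected.nonempty
  cases subsingleton_or_nontrivial V
  · exact ⟨Classical.arbitrary V, Set.subsingleton_of_subsingleton⟩
  · obtain ⟨r, hr⟩ := hT.exists_vert_degree_one_of_nontrivial
    rw [degree_eq_one_iff_existsUnique_adj] at hr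
    exact ⟨r, fun _ hx _ hy => hr.unique hx hy⟩

theorem nonempty_iso_pathGraph [Finite V] (hT : T.IsTree)
    (hdeg : ∀ v, (T.neighborSet v).ncard ≤ 2) : Nonempty (T ≃g pathGraph (Nat.card V)) := by
  have := Fintype.ofFinite V
  obtain ⟨r, hr⟩ := exists_subsingleton_neighborSet hT
  have hinj := dist_injective_of_ncard_neighborSet_le_two hT.connected hdeg hr
  have hlt (v : V) : T.dist r v < Nat.card V := by
    obtain ⟨p, hp, hpd⟩ := hT.connected.exists_path_of_dist r v
    rw [Nat.card_eq_fintype_card]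
    exact hpd ▸ hp.length_lt
  let f : V → Fin (Nat.card V) := fun v => ⟨T.dist r v, hlt v⟩
  have hf : Function.Injective f := fun u v h => hinj (congrArg Fin.val h)
  have hadj (u v : V) (h : T.dist r u + 1 = T.dist r v) : T.Adj u v := by
    obtain ⟨w, hvw, hw⟩ := exists_adj_dist_add_one_eq hT.connected (r := r) (v := v)
      (by rintro rfl; simp at h)
    obtain rfl := hinj (show T.dist r u = T.dist r w by omega)
    exact hvw.symm
  refine ⟨Equiv.ofBijective f ((Nat.bijective_iff_injective_and_card f).2 ⟨hf, by simp⟩), ?_⟩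
  intro u v
  simp only [Equiv.ofBijective_apply, pathGraph_adj, f]
  refine ⟨fun h => h.elim (hadj u v) fun h => (hadj v u h).symm, fun h => ?_⟩
  have := hT.dist_eq_dist_add_one_of_adj r h
  omega

theorem pathGraph_isContained_pathGraph {m n : ℕ} (h : m ≤ n) :
    (pathGraph m).IsContained (pathGraph n) :=
  ⟨⟨⟨Fin.castLE h, fun {u v} huv => by simpa [pathGraph_adj] using huv⟩, Fin.castLE_injective h⟩⟩

theorem ncard_neighborSet_pathGraph_le_two {n : ℕ} (i : Fin n) :
    ((pathGraph n).neighborSet i).ncard ≤ 2 := by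
  by_contra! h
  obtain ⟨a, ha, b, hb, c, hc, hab, hac, hbc⟩ := (Set.two_lt_ncard).1 h
  simp only [mem_neighborSet, pathGraph_adj, ne_eq, Fin.ext_iff] at *
  omega

instance decidableRelGraphG3Adj : DecidableRel graphG3.Adj :=
  inferInstanceAs (DecidableRel (fromEdgeSet {s(0, 1), s(1, 2), s(2, 3), s(3, 4), s(2, 5)}).Adj)

theorem isContained_graphG3_of_injOn (hT : T.IsTree) {v a b : V} (ha : T.Adj v a) (hb : T.Adj v b)
    (hab : a ≠ b) {r : V → V}
    (hr : ∀ u ∉ ({v, a, b} : Set V), r u ∈ ({v, a, b} : Set V) ∧ T.Adj u (r u))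
    (hinj : Set.InjOn r {v, a, b}ᶜ) : T.IsContained graphG3 := by
  classical
  let core : V → Fin 6 := fun u => if u = v then 2 else if u = a then 1 else 3
  let leaf : V → Fin 6 := fun u => if u = v then 5 else if u = a then 0 else 4
  let f : V → Fin 6 := fun u => if u ∈ ({v, a, b} : Set V) then core u else leaf (r u)
  have hfv : f v = 2 := by simp [f, core]
  have hfa : f a = 1 := by simp [f, core, ha.ne']
  have hfb : f b = 3 := by simp [f, core, hb.ne', hab.symm]
  have hleaf (u : V) (hu : u ∉ ({v, a, b} : Set V)) :
      r u = v ∧ f u = 5 ∨ r u = a ∧ f u = 0 ∨ r u = b ∧ f u = 4 := by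
    simp only [f, if_neg hu, leaf]
    obtain ⟨h | h | h, -⟩ := hr u hu
    · simp [h]
    · simp [h, ha.ne']
    · simp [Set.mem_singleton_iff.1 h, hb.ne', hab.symm]
  refine isContained_of_connected_inf_comap hT (f := f) ?_ ?_
  · intro x y hxy
    have hxyr (hx : x ∉ ({v, a, b} : Set V)) (hy : y ∉ ({v, a, b} : Set V)) :
        r x = r y → x = y := fun h => hinj hx hy h
    have hx := hleaf x
    have hy := hleaf y
    grind
  · have hva : (T ⊓ graphG3.comap f).Adj v a := ⟨ha, by rw [comap_adj, hfv, hfa]; decide⟩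
    have hvb : (T ⊓ graphG3.comap f).Adj v b := ⟨hb, by rw [comap_adj, hfv, hfb]; decide⟩
    have hcore : ∀ u ∈ ({v, a, b} : Set V), (T ⊓ graphG3.comap f).Reachable v u := by
      rintro u (rfl | rfl | rfl)
      exacts [.rfl, hva.reachable, hvb.reachable]
    refine connected_iff_exists_forall_reachable _ |>.2 ⟨v, fun u => ?_⟩
    by_cases hu : u ∈ ({v, a, b} : Set V)
    · exact hcore u hu
    · refine (hcore _ (hr u hu).1).trans (Adj.reachable ⟨(hr u hu).2.symm, ?_⟩)
      rw [comap_adj]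
      obtain ⟨h, hu⟩ | ⟨h, hu⟩ | ⟨h, hu⟩ := hleaf u hu <;> rw [h, hu]
      · rw [hfv]; decide
      · rw [hfa]; decide
      · rw [hfb]; decide

end Trees

/-- All color classes other than its own are at distance one from the vertex `v`, when `g` lists
the color codes. -/
def IsNear {V : Type*} {k : ℕ} (g : V → Fin k → ℕ) (v : V) : Prop :=
  ∀ i, g v i ≤ 1

namespace IsPendantLocatingCode

section ManyColors

variable {V : Type*} {G : SimpleGraph V} {k : ℕ} {c c' : V → Fin k} {g : V → Fin k → ℕ}

theorem eq_pendantCode (hg : IsPendantLocatingCode G c c' g) {u w : V} (hcu : c u = c' w)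
    (hcw : c w = c' u) (h : ∀ i, c u ≠ i → c' u ≠ i → g u i = g w i + 1) :
    g u = pendantCode c' g w := by
  funext i
  unfold pendantCode
  split_ifs with hi
  · exact (hg.eq_zero_iff u i).2 (hcu.trans hi)
  · by_cases hi' : c' u = i
    · subst hi'
      rw [hg.eq_one, (hg.eq_zero_iff w _).2 hcw]
    · exact h i (hcu ▸ hi) hi'

theorem three_le_of_adj (hg : IsPendantLocatingCode G c c' g) {u v : V} (huv : G.Adj u v) :
    3 ≤ k := by
  by_contra! hk
  have := hg.color_ne u v huv
  have := hg.color_ne_pendant u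
  have := hg.color_ne_pendant v
  have hcu : c u = c' v := by omega
  have hcv : c v = c' u := by omega
  exact hg.ne_pendantCode u v (hg.eq_pendantCode hcu hcv fun i _ _ => by omega)

theorem eq_of_isNear (hg : IsPendantLocatingCode G c c' g) {u v : V} (hu : IsNear g u)
    (hv : IsNear g v) (huv : c u = c v) : u = v := by
  refine hg.injective (funext fun i => ?_)
  have := hu i
  have := hv i
  have := hg.eq_zero_iff u i
  have := huv ▸ hg.eq_zero_iff v i
  omega

theorem exists_two_le_of_not_isNear (hg : IsPendantLocatingCode G c c' g) {u : V}
    (hu : ¬ IsNear g u) : ∃ i, c u ≠ i ∧ c' u ≠ i ∧ 2 ≤ g u i := by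
  obtain ⟨i, hi⟩ := not_forall.1 hu
  refine ⟨i, ?_, ?_, by omega⟩
  · rw [Ne, ← hg.eq_zero_iff]
    omega
  · rintro rfl
    exact hi (hg.eq_one u).le

end ManyColors

section ThreeColors

variable {V : Type*} {G : SimpleGraph V} {c c' : V → Fin 3} {g : V → Fin 3 → ℕ}

theorem color_eq_of_adj_of_not_isNear (hg : IsPendantLocatingCode G c c' g) {u w : V}
    (hu : ¬ IsNear g u) (huw : G.Adj u w) : c w = c' u := by
  obtain ⟨i, hi, hi', hui⟩ := hg.exists_two_le_of_not_isNear hu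
  have hle := hg.le_add_one u w huw i
  have hwi : c w ≠ i := by
    rw [Ne, ← hg.eq_zero_iff]
    omega
  have := hg.color_ne u w huw
  have := hg.color_ne_pendant u
  omega

theorem exists_isNear_adj (hg : IsPendantLocatingCode G c c' g) {u : V} (hu : ¬ IsNear g u) :
    ∃ w, G.Adj u w ∧ IsNear g w := by
  obtain ⟨i, hi, hi', -⟩ := hg.exists_two_le_of_not_isNear hu
  obtain ⟨w, huw, hw⟩ := hg.exists_adj u i hi hi'
  refine ⟨w, huw, ?_⟩
  -- Otherwise `w` has color `c' u` and its pendant vertex has color `c u`, so that the pendant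
  -- vertex has the same code as `u`.
  by_contra hwn
  refine hg.ne_pendantCode u w (hg.eq_pendantCode (hg.color_eq_of_adj_of_not_isNear hwn huw.symm)
    (hg.color_eq_of_adj_of_not_isNear hu huw) fun j hj hj' => ?_)
  have := hg.color_ne_pendant u
  obtain rfl : i = j := by omega
  exact hw.symm

theorem eq_two_of_not_isNear (hg : IsPendantLocatingCode G c c' g) {u : V} (hu : ¬ IsNear g u)
    {i : Fin 3} (hi : c u ≠ i) (hi' : c' u ≠ i) : g u i = 2 := by
  obtain ⟨j, hj, hj', huj⟩ := hg.exists_two_le_of_not_isNear hu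
  have := hg.color_ne_pendant u
  obtain rfl : i = j := by omega
  obtain ⟨w, huw, hw⟩ := hg.exists_isNear_adj hu
  have := hg.le_add_one u w huw i
  have := hw i
  omega

theorem eq_of_not_isNear (hg : IsPendantLocatingCode G c c' g) {u v : V} (hu : ¬ IsNear g u)
    (hv : ¬ IsNear g v) (hc : c u = c v) (hc' : c' u = c' v) : u = v := by
  refine hg.injective (funext fun i => ?_)
  by_cases hi : c u = i
  · rw [(hg.eq_zero_iff u i).2 hi, (hg.eq_zero_iff v i).2 (hc ▸ hi)]
  by_cases hi' : c' u = i
  · rw [← hi', hg.eq_one, hc', hg.eq_one]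
  · rw [hg.eq_two_of_not_isNear hu hi hi', hg.eq_two_of_not_isNear hv (hc ▸ hi) (hc' ▸ hi')]

theorem eq_of_adj_of_not_isNear (hg : IsPendantLocatingCode G c c' g) {v x y : V}
    (hx : ¬ IsNear g x) (hy : ¬ IsNear g y) (hvx : G.Adj v x) (hvy : G.Adj v y)
    (hxy : c x = c y) : x = y :=
  hg.eq_of_not_isNear hx hy hxy ((hg.color_eq_of_adj_of_not_isNear hx hvx.symm).symm.trans
    (hg.color_eq_of_adj_of_not_isNear hy hvy.symm))

theorem color_ne_pendant_of_adj (hg : IsPendantLocatingCode G c c' g) {v x : V}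
    (hv : IsNear g v) (hx : ¬ IsNear g x) (hvx : G.Adj v x) : c x ≠ c' v := by
  intro hxv
  have hvx' := hg.color_eq_of_adj_of_not_isNear hx hvx.symm
  refine hg.ne_pendantCode x v (hg.eq_pendantCode hxv hvx' fun i hi hi' => ?_)
  have := hv i
  have := (hg.eq_zero_iff v i).not.2 (hvx' ▸ hi')
  have := hg.eq_two_of_not_isNear hx hi hi'
  omega

theorem eq_of_isNear_of_adj_of_not_isNear (hg : IsPendantLocatingCode G c c' g) {v x y : V}
    (hv : IsNear g v) (hx : ¬ IsNear g x) (hy : ¬ IsNear g y) (hvx : G.Adj v x)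
    (hvy : G.Adj v y) : x = y := by
  refine hg.eq_of_adj_of_not_isNear hx hy hvx hvy ?_
  have := hg.color_ne v x hvx
  have := hg.color_ne v y hvy
  have := hg.color_ne_pendant v
  have := hg.color_ne_pendant_of_adj hv hx hvx
  have := hg.color_ne_pendant_of_adj hv hy hvy
  omega

theorem isNear_of_two_lt_ncard_neighborSet [Finite V] (hg : IsPendantLocatingCode G c c' g)
    {v : V} (hv : 2 < (G.neighborSet v).ncard) : IsNear g v := by
  by_contra hn
  have hcolor {x y : V} (hx : G.Adj v x) (hy : G.Adj v y) : c x = c y :=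
    (hg.color_eq_of_adj_of_not_isNear hn hx).trans (hg.color_eq_of_adj_of_not_isNear hn hy).symm
  have heq {x y : V} (hx : G.Adj v x) (hy : G.Adj v y) (hxy : IsNear g x ↔ IsNear g y) :
      x = y := by
    by_cases h : IsNear g x
    · exact hg.eq_of_isNear h (hxy.1 h) (hcolor hx hy)
    · exact hg.eq_of_adj_of_not_isNear h (hxy.not.1 h) hx hy (hcolor hx hy)
  obtain ⟨x, hx, y, hy, z, hz, hxy, hxz, hyz⟩ := (Set.two_lt_ncard).1 hv
  have := heq hx hy
  have := heq hx hz
  have := heq hy hz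
  tauto

theorem exists_isNear_adj_ne [Finite V] (hg : IsPendantLocatingCode G c c' g) {v : V}
    (hv : 2 < (G.neighborSet v).ncard) :
    ∃ a b, a ≠ b ∧ G.Adj v a ∧ G.Adj v b ∧ IsNear g a ∧ IsNear g b := by
  have hn := hg.isNear_of_two_lt_ncard_neighborSet hv
  obtain ⟨x, hx, y, hy, z, hz, hxy, hxz, hyz⟩ := (Set.two_lt_ncard).1 hv
  rw [mem_neighborSet] at hx hy hz
  by_cases hxn : IsNear g x
  · by_cases hyn : IsNear g y
    · exact ⟨x, y, hxy, hx, hy, hxn, hyn⟩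
    · exact ⟨x, z, hxz, hx, hz, hxn, by_contra fun hzn =>
        hyz (hg.eq_of_isNear_of_adj_of_not_isNear hn hyn hzn hy hz)⟩
  · exact ⟨y, z, hyz, hy, hz, by_contra fun hyn =>
      hxy (hg.eq_of_isNear_of_adj_of_not_isNear hn hxn hyn hx hy), by_contra fun hzn =>
      hxz (hg.eq_of_isNear_of_adj_of_not_isNear hn hxn hzn hx hz)⟩

theorem exists_isNear_root (hg : IsPendantLocatingCode G c c' g) :
    ∃ r : V → V, (∀ u, IsNear g (r u)) ∧ (∀ u, IsNear g u → r u = u) ∧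
      (∀ u, ¬ IsNear g u → G.Adj u (r u)) ∧ Set.InjOn r {u | ¬ IsNear g u} := by
  have hroot (u : V) : ∃ w, IsNear g w ∧ (IsNear g u → w = u) ∧ (¬ IsNear g u → G.Adj u w) := by
    by_cases hu : IsNear g u
    · exact ⟨u, hu, fun _ => rfl, fun h => (h hu).elim⟩
    · obtain ⟨w, huw, hw⟩ := hg.exists_isNear_adj hu
      exact ⟨w, hw, fun h => (hu h).elim, fun _ => huw⟩
  choose r hnear hself hadj using hroot
  refine ⟨r, hnear, hself, hadj, fun u hu v hv huv => ?_⟩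
  exact hg.eq_of_isNear_of_adj_of_not_isNear (hnear u) hu hv (hadj u hu).symm
    (huv ▸ (hadj v hv).symm)

theorem exists_injective_fin_three_prod_bool (hg : IsPendantLocatingCode G c c' g) :
    ∃ f : V → Fin 3 × Bool, Function.Injective f := by
  classical
  obtain ⟨r, hnear, hself, -, hinj⟩ := hg.exists_isNear_root
  refine ⟨fun u => (c (r u), decide (IsNear g u)), fun u v huv => ?_⟩
  obtain ⟨hc, hn⟩ := Prod.ext_iff.1 huv
  have hr : r u = r v := hg.eq_of_isNear (hnear u) (hnear v) hc
  rw [decide_eq_decide] at hn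
  by_cases hu : IsNear g u
  · rw [← hself u hu, ← hself v (hn.1 hu), hr]
  · exact hinj hu (hn.not.1 hu) hr

theorem isContained (hT : G.IsTree) (hg : IsPendantLocatingCode G c c' g) :
    G.IsContained (pathGraph 6) ∨ G.IsContained graphG3 := by
  obtain ⟨f, hf⟩ := hg.exists_injective_fin_three_prod_bool
  have : Finite V := .of_injective f hf
  have hcard : Nat.card V ≤ 6 := by simpa using Nat.card_le_card_of_injective f hf
  by_cases! hdeg : ∀ v, (G.neighborSet v).ncard ≤ 2
  · obtain ⟨e⟩ := nonempty_iso_pathGraph hT hdeg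
    exact .inl ((isContained_congr_left e).2 (pathGraph_isContained_pathGraph hcard))
  · obtain ⟨v, hv⟩ := hdeg
    have hvn := hg.isNear_of_two_lt_ncard_neighborSet hv
    obtain ⟨a, b, hab, ha, hb, han, hbn⟩ := hg.exists_isNear_adj_ne hv
    obtain ⟨r, hnear, -, hadj, hinj⟩ := hg.exists_isNear_root
    have hmem (u : V) (hu : IsNear g u) : u ∈ ({v, a, b} : Set V) := by
      have := hg.color_ne v a ha
      have := hg.color_ne v b hb
      have := mt (hg.eq_of_isNear han hbn) hab
      obtain h | h | h : c u = c v ∨ c u = c a ∨ c u = c b := by omega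
      · exact .inl (hg.eq_of_isNear hu hvn h)
      · exact .inr (.inl (hg.eq_of_isNear hu han h))
      · exact .inr (.inr (hg.eq_of_isNear hu hbn h))
    refine .inr (isContained_graphG3_of_injOn hT ha hb hab (r := r) (fun u hu => ?_) (hinj.mono ?_))
    · exact ⟨hmem _ (hnear u), hadj u fun h => hu (hmem u h)⟩
    · exact fun u hu h => hu (hmem u h)

end ThreeColors

end IsPendantLocatingCode

namespace IsPendantLocatingCode

section Maps

variable {V W : Type*} {G : SimpleGraph V} {H : SimpleGraph W} {k : ℕ} {c c' : W → Fin k}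
  {g : W → Fin k → ℕ}

theorem comap (hg : IsPendantLocatingCode H c c' g) (f : Copy G H)
    (hf : ∀ v i, c (f v) ≠ i → c' (f v) ≠ i → ∃ w, G.Adj v w ∧ g (f w) i + 1 = g (f v) i) :
    IsPendantLocatingCode G (c ∘ f) (c' ∘ f) (g ∘ f) where
  color_ne _ _ h := hg.color_ne _ _ (f.toHom.map_adj h)
  eq_zero_iff v := hg.eq_zero_iff (f v)
  eq_one v := hg.eq_one (f v)
  le_add_one _ _ h := hg.le_add_one _ _ (f.toHom.map_adj h)
  exists_adj := hf
  injective := hg.injective.comp f.injective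
  ne_pendantCode u v := hg.ne_pendantCode (f u) (f v)

theorem comap_iso (hg : IsPendantLocatingCode H c c' g) (e : G ≃g H) :
    IsPendantLocatingCode G (c ∘ e) (c' ∘ e) (g ∘ e) :=
  hg.comap e.toCopy fun v i hi hi' => by
    obtain ⟨w, hw, hwi⟩ := hg.exists_adj (e v) i hi hi'
    exact ⟨e.symm w, by simpa [← e.map_adj_iff] using hw, by simpa using hwi⟩

end Maps

end IsPendantLocatingCode

section NewColor

variable {V : Type*} {G : SimpleGraph V} {k : ℕ} {c : V → Fin k} {g : V → Fin k → ℕ}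

theorem IsLocalCode.isPendantLocatingCode_snoc (hc : ∀ u v, G.Adj u v → c u ≠ c v)
    (hg : IsLocalCode G c g) (hinj : Function.Injective g) :
    IsPendantLocatingCode G (Fin.castSucc ∘ c) (fun _ => Fin.last k)
      (fun v => (Fin.snoc (g v) 1 : Fin (k + 1) → ℕ)) where
  color_ne u v h := (Fin.castSucc_injective k).ne (hc u v h)
  eq_zero_iff v i := by
    cases i using Fin.lastCases with
    | last => simp [(Fin.castSucc_lt_last _).ne]
    | cast i => simp [hg.eq_zero_iff]
  eq_one v := Fin.snoc_last _ _
  le_add_one u v h i := by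
    cases i using Fin.lastCases with
    | last => simp
    | cast i => simpa using hg.le_add_one u v h i
  exists_adj v i hi hi' := by
    cases i using Fin.lastCases with
    | last => exact (hi' rfl).elim
    | cast i =>
      have hvi : c v ≠ i := fun h => hi (congrArg Fin.castSucc h)
      simpa using hg.exists_adj v i ((hg.eq_zero_iff v i).not.2 hvi)
  injective u v h := hinj (Fin.snoc_injective2 h).1
  ne_pendantCode u v h := by simpa [pendantCode] using congrFun h (Fin.last k)

theorem HasLocatingColoring.corona_succ {W : Type*} [Unique W] {H : SimpleGraph W}
    (hG : G.Connected) (h : HasLocatingColoring G k) :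
    HasLocatingColoring (corona G H) (k + 1) := by
  obtain ⟨c, g, hc, hg, hinj⟩ := (hasLocatingColoring_iff hG).1 h
  exact (hg.isPendantLocatingCode_snoc hc hinj).hasLocatingColoring_corona hG H

end NewColor

section Copies

variable {V W : Type*} {G : SimpleGraph V} {H : SimpleGraph W}

theorem image_neighborSet_subset_of_copy (f : Copy G H) (v : V) :
    f '' G.neighborSet v ⊆ H.neighborSet (f v) :=
  Set.image_subset_iff.2 fun _ h => f.toHom.map_adj h

theorem ncard_neighborSet_le_of_copy [Finite W] (f : Copy G H) (v : V) :
    (G.neighborSet v).ncard ≤ (H.neighborSet (f v)).ncard := by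
  rw [← Set.ncard_image_of_injective _ f.injective]
  exact Set.ncard_le_ncard (image_neighborSet_subset_of_copy f v)

end Copies

section ThreeColors

variable {V : Type*} {T : SimpleGraph V}

/-- Color codes for three colors: `t v` is the distance from `v` to the color that neither `v` nor
its pendant vertex has. -/
def threeColorCode (c c' : V → Fin 3) (t : V → ℕ) (v : V) (i : Fin 3) : ℕ :=
  if c v = i then 0 else if c' v = i then 1 else t v

instance decidableRelPathGraphAdj (n : ℕ) : DecidableRel (pathGraph n).Adj := fun _ _ =>
  decidable_of_iff _ pathGraph_adj.symm

theorem exists_isPendantLocatingCode_pathGraph {n : ℕ} (h2 : 2 ≤ n) (h6 : n ≤ 6) :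
    ∃ c c' t, IsPendantLocatingCode (pathGraph n) c c' (threeColorCode c c' t) := by
  interval_cases n
  · exact ⟨![0, 1], ![2, 2], ![1, 1], by constructor <;> decide⟩
  · exact ⟨![1, 0, 2], ![2, 2, 1], ![1, 1, 1], by constructor <;> decide⟩
  · exact ⟨![0, 1, 0, 2], ![1, 2, 2, 1], ![2, 1, 1, 1], by constructor <;> decide⟩
  · exact ⟨![0, 1, 0, 2, 0], ![1, 2, 2, 1, 2], ![2, 1, 1, 1, 2], by constructor <;> decide⟩
  · exact ⟨![0, 1, 0, 1, 2, 0], ![2, 0, 1, 2, 1, 2], ![1, 2, 2, 1, 1, 2],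
      by constructor <;> decide⟩

/-- The next vertex of `G₃` on the way to the edge between `1` and `2`: in the coloring of
`exists_isPendantLocatingCode_graphG3` it is closer to the color that neither the vertex nor its
pendant vertex has. -/
def graphG3Next : Fin 6 → Fin 6 :=
  ![1, 2, 1, 2, 3, 2]

theorem exists_isPendantLocatingCode_graphG3 :
    ∃ (c c' : Fin 6 → Fin 3) (g : Fin 6 → Fin 3 → ℕ), IsPendantLocatingCode graphG3 c c' g ∧
      ∀ x i, c x ≠ i → c' x ≠ i → g (graphG3Next x) i + 1 = g x i :=
  ⟨![0, 1, 0, 2, 0, 1], ![1, 2, 2, 1, 2, 0],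
    threeColorCode ![0, 1, 0, 2, 0, 1] ![1, 2, 2, 1, 2, 0] ![2, 1, 1, 1, 2, 2],
    by constructor <;> decide, by decide⟩

theorem ncard_neighborSet_graphG3 (x : Fin 6) :
    (graphG3.neighborSet x).ncard = ![1, 2, 3, 2, 1, 1] x := by
  rw [Set.ncard_eq_toFinset_card']
  revert x
  decide

theorem apply_eq_two_of_copy_graphG3 (f : Copy T graphG3) {v : V}
    (hv : 2 < (T.neighborSet v).ncard) : f v = 2 := by
  have h := hv.trans_le (ncard_neighborSet_le_of_copy f v)
  rw [ncard_neighborSet_graphG3] at h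
  revert h
  generalize f v = x
  revert x
  decide

theorem image_neighborSet_of_copy_graphG3 (f : Copy T graphG3) {v : V}
    (hv : 2 < (T.neighborSet v).ncard) : f '' T.neighborSet v = graphG3.neighborSet 2 := by
  have hinj : Function.Injective f := f.injective
  have hsub := image_neighborSet_subset_of_copy f v
  rw [apply_eq_two_of_copy_graphG3 f hv] at hsub
  refine Set.eq_of_subset_of_ncard_le hsub ?_
  rw [ncard_neighborSet_graphG3, Set.ncard_image_of_injective _ hinj]
  exact hv

theorem exists_adj_apply_eq_graphG3Next (hT : T.Connected) (f : Copy T graphG3) {v : V}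
    (hv : 2 < (T.neighborSet v).ncard) (u : V) : ∃ w, T.Adj u w ∧ f w = graphG3Next (f u) := by
  have hinj : Function.Injective f := f.injective
  have hfv := apply_eq_two_of_copy_graphG3 f hv
  have himage := image_neighborSet_of_copy_graphG3 f hv
  obtain ⟨a, hva, hfa⟩ : 1 ∈ f '' T.neighborSet v := by
    rw [himage, mem_neighborSet]
    decide
  by_cases hu : u = v
  · subst hu
    exact ⟨a, hva, by rw [hfa, hfv]; decide⟩
  by_cases hadj : graphG3.Adj 2 (f u)
  · have hnext : ∀ x, graphG3.Adj 2 x → graphG3Next x = 2 := by decide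
    have huv : u ∈ T.neighborSet v := by
      rwa [← mem_neighborSet, ← himage, hinj.mem_set_image] at hadj
    exact ⟨v, huv.symm, by rw [hfv, hnext _ hadj]⟩
  · have : Nontrivial V := ⟨u, v, hu⟩
    have hnext : ∀ x y, x ≠ 2 → ¬ graphG3.Adj 2 x → graphG3.Adj x y → y = graphG3Next x := by
      decide
    obtain ⟨w, huw⟩ := hT.preconnected.exists_adj_of_nontrivial u
    exact ⟨w, huw, hnext _ _ (hfv ▸ hinj.ne hu) hadj (f.toHom.map_adj huw)⟩

theorem exists_isPendantLocatingCode [Nontrivial V] (hT : T.IsTree)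
    (h : T.IsContained (pathGraph 6) ∨ T.IsContained graphG3) :
    ∃ (c c' : V → Fin 3) (g : V → Fin 3 → ℕ), IsPendantLocatingCode T c c' g := by
  obtain ⟨f, hf⟩ : ∃ f : V → Fin 6, Function.Injective f :=
    h.elim (fun ⟨f⟩ => ⟨f, f.injective⟩) fun ⟨f⟩ => ⟨f, f.injective⟩
  have : Finite V := .of_injective f hf
  by_cases! hdeg : ∀ v, (T.neighborSet v).ncard ≤ 2
  · obtain ⟨e⟩ := nonempty_iso_pathGraph hT hdeg
    obtain ⟨c, c', t, hg⟩ := exists_isPendantLocatingCode_pathGraph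
      (Finite.one_lt_card (α := V)) (by simpa using Nat.card_le_card_of_injective f hf)
    exact ⟨_, _, _, hg.comap_iso e⟩
  obtain ⟨v, hv⟩ := hdeg
  obtain ⟨⟨f⟩⟩ | ⟨⟨f⟩⟩ := h
  · exact (hv.not_ge ((ncard_neighborSet_le_of_copy f v).trans
      (ncard_neighborSet_pathGraph_le_two _))).elim
  · obtain ⟨c, c', g, hg, hnext⟩ := exists_isPendantLocatingCode_graphG3
    refine ⟨_, _, _, hg.comap f fun u i hi hi' => ?_⟩
    obtain ⟨w, huw, hw⟩ := exists_adj_apply_eq_graphG3Next hT.connected f hv u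
    exact ⟨w, huw, by rw [hw, hnext _ i hi hi']⟩

end ThreeColors

section Main

variable {V W : Type*} [Nontrivial V] [Unique W] {T : SimpleGraph V} {H : SimpleGraph W}

theorem hasLocatingColoring_three_corona_iff (hT : T.IsTree) :
    HasLocatingColoring (corona T H) 3 ↔
      T.IsContained (pathGraph 6) ∨ T.IsContained graphG3 := by
  rw [hasLocatingColoring_corona_iff hT.connected]
  exact ⟨fun ⟨_, _, _, hg⟩ => hg.isContained hT, exists_isPendantLocatingCode hT⟩

theorem HasLocatingColoring.three_le_of_corona (hT : T.Connected) {k : ℕ}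
    (h : HasLocatingColoring (corona T H) k) : 3 ≤ k := by
  obtain ⟨c, c', g, hg⟩ := (hasLocatingColoring_corona_iff hT).1 h
  obtain ⟨w, hw⟩ := hT.preconnected.exists_adj_of_nontrivial (Classical.arbitrary V)
  exact hg.three_le_of_adj hw

end Main

end LocatingChromatic

open LocatingChromatic

theorem mainTheorem3_general {V W : Type*} [Nontrivial V] [Unique W] (T : SimpleGraph V)
    (H : SimpleGraph W) (hT : T.IsTree) :
    (locatingChromaticNumber (corona T H) = 3 ↔
      T.IsContained (SimpleGraph.pathGraph 6) ∨ T.IsContained graphG3) ∧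
    (locatingChromaticNumber T = 3 →
      ¬ (T.IsContained (SimpleGraph.pathGraph 6) ∨ T.IsContained graphG3) →
        locatingChromaticNumber (corona T H) = 4) := by
  have three_le {k : ℕ} (h : HasLocatingColoring (corona T H) k) :
      3 ≤ locatingChromaticNumber (corona T H) :=
    h.hasLocatingColoring_locatingChromaticNumber.three_le_of_corona hT.connected
  have eq_three_iff : locatingChromaticNumber (corona T H) = 3 ↔
      T.IsContained (SimpleGraph.pathGraph 6) ∨ T.IsContained graphG3 := by
    rw [← hasLocatingColoring_three_corona_iff (H := H) hT]
    exact ⟨hasLocatingColoring_of_locatingChromaticNumber_eq three_ne_zero,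
      fun h => le_antisymm h.locatingChromaticNumber_le (three_le h)⟩
  refine ⟨eq_three_iff, fun hχ hne => ?_⟩
  have hfour : HasLocatingColoring (corona T H) 4 :=
    (hasLocatingColoring_of_locatingChromaticNumber_eq three_ne_zero hχ).corona_succ hT.connected
  exact le_antisymm hfour.locatingChromaticNumber_le
    (Nat.lt_of_le_of_ne (three_le hfour) (Ne.symm (eq_three_iff.not.2 hne)))

theorem mainTheorem3 {V : Type*} [Fintype V] (T : SimpleGraph V) (hT : T.IsTree)
    (hn : 2 ≤ Fintype.card V) (hχ : LocatingChromatic.locatingChromaticNumber T = 3) :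
    ((T.IsContained (SimpleGraph.pathGraph 6) ∨ T.IsContained LocatingChromatic.graphG3) →
      LocatingChromatic.locatingChromaticNumber
        (LocatingChromatic.corona T (SimpleGraph.completeGraph (Fin 1))ᶜ) = 3) ∧
    (¬ (T.IsContained (SimpleGraph.pathGraph 6) ∨ T.IsContained LocatingChromatic.graphG3) →
      LocatingChromatic.locatingChromaticNumber
        (LocatingChromatic.corona T (SimpleGraph.completeGraph (Fin 1))ᶜ) = 4) := by
  have : Nontrivial V := Fintype.one_lt_card_iff_nontrivial.1 hn
  have h := mainTheorem3_general T (SimpleGraph.completeGraph (Fin 1))ᶜ hT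
  exact ⟨h.1.2, h.2 hχ⟩
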